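/- Let $\mathfrak{o}$ be a Dedekind domain such that $\mathfrak{o}/x\mathfrak{o}$ is finite for every $x\in\mathfrak{o}\setminus\{0\}$, and for an ideal $\mathfrak{c}$ of $\mathfrak{o}$ let $\operatorname{N}(\mathfrak{c})=|\mathfrak{o}/\mathfrak{c}|$. Let $U=\operatorname{GL}_2(\mathfrak{o})$, let $A$ be a $2\times 2$ matrix with entries in $\mathfrak{o}$ and $\det A\neq 0$, let $\mathfrak{d}_1(A)$ be the ideal of $\mathfrak{o}$ generated by the entries of $A$, and let $\mathfrak{d}_2(A)=(\det A)\mathfrak{o}$. For an ideal $\mathfrak{a}$ of $\mathfrak{o}$, let $\mu_{\mathfrak{a}}(A)$ be the number of right cosets $UB$ (where $B$ is a $2\times2$ matrix with entries in $\mathfrak{o}$ and $\det B\neq0$) which are contained in $UAU$ and for which the ideal generated by the two entries of the first column of $B$ equals $\mathfrak{a}$ (this ideal depends only on $UB$). For fractional ideals, $\mathfrak{x}\mid\mathfrak{y}$ means $\mathfrak{y}=\mathfrak{x}\mathfrak{c}$ for some ideal $\mathfrak{c}$ of $\mathfrak{o}$. Then $\mu_{\mathfrak{a}}(A)$ is finite.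 If $\mathfrak{d}_1(A)\mid\mathfrak{a}\mid\mathfrak{d}_2(A)\mathfrak{d}_1(A)^{-1}$, then \[ \mu_{\mathfrak{a}}(A)=\frac{\operatorname{N}(\mathfrak{d}_2(A))}{\operatorname{N}(\mathfrak{a})\operatorname{N}(\mathfrak{d}_1(A))}\prod_{\mathfrak{p}}\bigl(1-\operatorname{N}(\mathfrak{p})^{-1}\bigr), \] where $\mathfrak{p}$ runs over the (finitely many) prime ideals of $\mathfrak{o}$ dividing $\mathfrak{a}\mathfrak{d}_1(A)^{-1}+\mathfrak{d}_2(A)\mathfrak{d}_1(A)^{-1}\mathfrak{a}^{-1}$. Otherwise, $\mu_{\mathfrak{a}}(A)=0$. -/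

import Mathlib

open scoped nonZeroDivisors MatrixGroups

namespace RightCosets

section Matrices

variable {O : Type*} [CommRing O]

/-- The first determinantal divisor of a `2 × 2` matrix: the ideal generated by its entries. -/
def d₁ (A : Matrix (Fin 2) (Fin 2) O) : Ideal O :=
  Ideal.span {A 0 0, A 0 1, A 1 0, A 1 1}

/-- The second determinantal divisor of a `2 × 2` matrix: the ideal generated by `det A`. -/
def d₂ (A : Matrix (Fin 2) (Fin 2) O) : Ideal O :=
  Ideal.span {A.det}

/-- The g.c.d. of the first column of a `2 × 2` matrix, as an ideal. -/
def g (A : Matrix (Fin 2) (Fin 2) O) : Ideal O :=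
  Ideal.span {A 0 0, A 1 0}

/-- The right coset `U B`, where `U = GL₂(O)`. -/
def rightCoset (B : Matrix (Fin 2) (Fin 2) O) : Set (Matrix (Fin 2) (Fin 2) O) :=
  {X | ∃ P : GL (Fin 2) O, X = (P : Matrix (Fin 2) (Fin 2) O) * B}

/-- The double coset `U A U`, where `U = GL₂(O)`. -/
def doubleCoset (A : Matrix (Fin 2) (Fin 2) O) : Set (Matrix (Fin 2) (Fin 2) O) :=
  {X | ∃ P Q : GL (Fin 2) O,
    X = (P : Matrix (Fin 2) (Fin 2) O) * A * (Q : Matrix (Fin 2) (Fin 2) O)}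

/-- The set of right cosets `U B` (with `det B ≠ 0`) which are contained in `U A U` and for which
the g.c.d. of the first column is the ideal `𝔞`. -/
def rightCosetsIn (A : Matrix (Fin 2) (Fin 2) O) (𝔞 : Ideal O) :
    Set (Set (Matrix (Fin 2) (Fin 2) O)) :=
  {C | ∃ B : Matrix (Fin 2) (Fin 2) O,
    B.det ≠ 0 ∧ g B = 𝔞 ∧ C = rightCoset B ∧ C ⊆ doubleCoset A}

/-- `μ_𝔞(A)`: the number of right cosets in `U A U` whose first column has g.c.d. `𝔞`. -/
noncomputable def mu (𝔞 : Ideal O) (A : Matrix (Fin 2) (Fin 2) O) : ℕ :=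
  (rightCosetsIn A 𝔞).ncard

/-- The norm `N(𝔞) = |O / 𝔞|` of an ideal. -/
noncomputable def norm (𝔞 : Ideal O) : ℕ := Nat.card (O ⧸ 𝔞)

end Matrices

section Divisibility

variable {O : Type*} [CommRing O] {K : Type*} [Field K] [Algebra O K]

/-- Divisibility of fractional ideals: `I` divides `J` if `J = I 𝔠` for an integral ideal `𝔠`.
(The relation `∣` of the monoid of fractional ideals would allow `𝔠` to be fractional.) -/
def Divides (I J : FractionalIdeal O⁰ K) : Prop :=
  ∃ 𝔠 : Ideal O, J = I * (𝔠 : FractionalIdeal O⁰ K)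

/-- The set of prime ideals dividing the fractional ideal `J`. -/
def primesDividing (J : FractionalIdeal O⁰ K) : Set (Ideal O) :=
  {𝔭 | 𝔭.IsPrime ∧ Divides (𝔭 : FractionalIdeal O⁰ K) J}

end Divisibility

end RightCosets

/-! Write 𝔡 = `d₁ A` and D = `A.det`. Over a Dedekind domain `d₁` and `d₂` classify the double
cosets of matrices with nonzero determinant (`mem_doubleCoset_iff`), so the cosets `U B` to be
counted are those with `d₁ B = 𝔡`, `d₂ B = (D)` and first column generating 𝔞. For such `B`, the
inclusions `g B ≤ d₁ B` and `d₂ B ≤ g B * d₁ B` force the two divisibility conditions; if these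
fail, there is no coset.

Otherwise 𝔞 = 𝔡J and (D) = 𝔞𝔡𝔫 with J, 𝔫 integral. Fix generators x, z of 𝔞. Each coset has a
representative with first column (x, z) and determinant D, whose second column matters only modulo
𝔡𝔫. Modulo 𝔡𝔫 the second columns with entries in 𝔡 are (y₀, w₀) + r(α, β), where (α, β) is
proportional to (x, z) and generates 𝔡 modulo 𝔡𝔫. The entries of the resulting matrix generate 𝔡(r,
J, 𝔫) (`d₁_eq_mul_sup_span`), so the cosets correspond to the classes r modulo 𝔫 that are coprime to
J + 𝔫 (`exists_parametrization`).

By the Chinese remainder theorem there are N(𝔫) ∏ (1 − N(𝔭)⁻¹) such classes, with 𝔭 over the primes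
containing J + 𝔫 (`card_avoiding_maximal`), and N(𝔫) = N((D)) / (N(𝔞) N(𝔡)) by multiplicativity of
the norm. -/

namespace RightCosets

/-! ### Invariants of cosets and double cosets -/

section Invariance

variable {O : Type*} [CommRing O]

theorem span_pair_le_iff {x y : O} {I : Ideal O} : Ideal.span {x, y} ≤ I ↔ x ∈ I ∧ y ∈ I := by
  simp [Ideal.span_le, Set.insert_subset_iff]

theorem d₁_le_iff {A : Matrix (Fin 2) (Fin 2) O} {I : Ideal O} :
    d₁ A ≤ I ↔ ∀ i j, A i j ∈ I := by
  simp [d₁, Ideal.span_le, Set.insert_subset_iff, Fin.forall_fin_two, and_assoc]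

theorem apply_mem_d₁ (A : Matrix (Fin 2) (Fin 2) O) (i j : Fin 2) : A i j ∈ d₁ A :=
  d₁_le_iff.1 le_rfl i j

theorem d₁_mul_le_right (P A : Matrix (Fin 2) (Fin 2) O) : d₁ (P * A) ≤ d₁ A := by
  rw [d₁_le_iff]
  intro i j
  rw [Matrix.mul_apply]
  exact sum_mem fun k _ => Ideal.mul_mem_left _ _ (apply_mem_d₁ A k j)

theorem d₁_mul_le_left (A Q : Matrix (Fin 2) (Fin 2) O) : d₁ (A * Q) ≤ d₁ A := by
  rw [d₁_le_iff]
  intro i j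
  rw [Matrix.mul_apply]
  exact sum_mem fun k _ => Ideal.mul_mem_right _ _ (apply_mem_d₁ A i k)

theorem d₁_unit_mul (P : GL (Fin 2) O) (A : Matrix (Fin 2) (Fin 2) O) :
    d₁ ((P : Matrix (Fin 2) (Fin 2) O) * A) = d₁ A := by
  refine le_antisymm (d₁_mul_le_right _ _) ?_
  conv_lhs => rw [← Units.inv_mul_cancel_left P A]
  exact d₁_mul_le_right _ _

theorem d₁_mul_unit (A : Matrix (Fin 2) (Fin 2) O) (Q : GL (Fin 2) O) :
    d₁ (A * (Q : Matrix (Fin 2) (Fin 2) O)) = d₁ A := by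
  refine le_antisymm (d₁_mul_le_left _ _) ?_
  conv_lhs => rw [← Units.mul_inv_cancel_right A Q]
  exact d₁_mul_le_left _ _

theorem isUnit_det_coe (P : GL (Fin 2) O) : IsUnit (P : Matrix (Fin 2) (Fin 2) O).det :=
  (Matrix.isUnit_iff_isUnit_det _).1 P.isUnit

theorem d₂_unit_mul (P : GL (Fin 2) O) (A : Matrix (Fin 2) (Fin 2) O) :
    d₂ ((P : Matrix (Fin 2) (Fin 2) O) * A) = d₂ A := by
  rw [d₂, d₂, Matrix.det_mul, Ideal.span_singleton_mul_left_unit (isUnit_det_coe P)]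

theorem d₂_mul_unit (A : Matrix (Fin 2) (Fin 2) O) (Q : GL (Fin 2) O) :
    d₂ (A * (Q : Matrix (Fin 2) (Fin 2) O)) = d₂ A := by
  rw [d₂, d₂, Matrix.det_mul, Ideal.span_singleton_mul_right_unit (isUnit_det_coe Q)]

theorem g_le_d₁ (B : Matrix (Fin 2) (Fin 2) O) : g B ≤ d₁ B :=
  span_pair_le_iff.2 ⟨apply_mem_d₁ B 0 0, apply_mem_d₁ B 1 0⟩

/-- Expansion of the determinant along the first column. This makes `𝔞 ∣ d₂ d₁⁻¹` a necessary
condition. -/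
theorem d₂_le_g_mul_d₁ (B : Matrix (Fin 2) (Fin 2) O) : d₂ B ≤ g B * d₁ B := by
  rw [d₂, Ideal.span_singleton_le_iff_mem, Matrix.det_fin_two]
  have h0 : B 0 0 ∈ g B := Ideal.subset_span (by simp)
  have h1 : B 1 0 ∈ g B := Ideal.subset_span (by simp)
  refine sub_mem (Ideal.mul_mem_mul h0 (apply_mem_d₁ B 1 1)) ?_
  rw [mul_comm (B 0 1)]
  exact Ideal.mul_mem_mul h1 (apply_mem_d₁ B 0 1)

theorem mem_rightCoset_self (B : Matrix (Fin 2) (Fin 2) O) : B ∈ rightCoset B :=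
  ⟨1, by simp⟩

theorem rightCoset_unit_mul (P : GL (Fin 2) O) (B : Matrix (Fin 2) (Fin 2) O) :
    rightCoset ((P : Matrix (Fin 2) (Fin 2) O) * B) = rightCoset B := by
  ext X
  constructor
  · rintro ⟨Q, rfl⟩
    exact ⟨Q * P, by simp [Matrix.mul_assoc]⟩
  · rintro ⟨Q, rfl⟩
    exact ⟨Q * P⁻¹, by
      rw [Units.val_mul, Matrix.mul_assoc, Units.inv_mul_cancel_left]⟩

theorem rightCoset_eq_iff {B C : Matrix (Fin 2) (Fin 2) O} :
    rightCoset B = rightCoset C ↔ ∃ P : GL (Fin 2) O, B = (P : Matrix (Fin 2) (Fin 2) O) * C := by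
  constructor
  · intro h
    have := mem_rightCoset_self B
    rwa [h] at this
  · rintro ⟨P, rfl⟩
    exact rightCoset_unit_mul P C

theorem rightCoset_subset_doubleCoset_iff {A B : Matrix (Fin 2) (Fin 2) O} :
    rightCoset B ⊆ doubleCoset A ↔ B ∈ doubleCoset A := by
  refine ⟨fun h => h (mem_rightCoset_self B), ?_⟩
  rintro ⟨P, Q, rfl⟩ X ⟨R, rfl⟩
  exact ⟨R * P, Q, by simp [Matrix.mul_assoc]⟩

theorem mem_doubleCoset_trans {A B C : Matrix (Fin 2) (Fin 2) O} (h : C ∈ doubleCoset B)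
    (h' : B ∈ doubleCoset A) : C ∈ doubleCoset A := by
  obtain ⟨P, Q, rfl⟩ := h
  obtain ⟨P', Q', rfl⟩ := h'
  exact ⟨P * P', Q' * Q, by simp [Matrix.mul_assoc]⟩

theorem mem_doubleCoset_symm {A B : Matrix (Fin 2) (Fin 2) O} (h : B ∈ doubleCoset A) :
    A ∈ doubleCoset B := by
  obtain ⟨P, Q, rfl⟩ := h
  exact ⟨P⁻¹, Q⁻¹, by
    rw [Matrix.mul_assoc, Matrix.mul_assoc, Matrix.mul_assoc, Units.mul_inv, Matrix.mul_one,
      Units.inv_mul_cancel_left]⟩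

theorem d₁_eq_of_mem_doubleCoset {A B : Matrix (Fin 2) (Fin 2) O} (h : B ∈ doubleCoset A) :
    d₁ B = d₁ A := by
  obtain ⟨P, Q, rfl⟩ := h
  rw [d₁_mul_unit, d₁_unit_mul]

theorem d₂_eq_of_mem_doubleCoset {A B : Matrix (Fin 2) (Fin 2) O} (h : B ∈ doubleCoset A) :
    d₂ B = d₂ A := by
  obtain ⟨P, Q, rfl⟩ := h
  rw [d₂_mul_unit, d₂_unit_mul]

theorem mem_span_pair_mul_iff {x z c : O} {I : Ideal O} :
    c ∈ Ideal.span {x, z} * I ↔ ∃ a ∈ I, ∃ b ∈ I, a * x + b * z = c := by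
  rw [Ideal.span_insert, Ideal.sup_mul, Submodule.mem_sup]
  simp only [Ideal.mem_span_singleton_mul]
  constructor
  · rintro ⟨_, ⟨a, ha, rfl⟩, _, ⟨b, hb, rfl⟩, rfl⟩
    exact ⟨a, ha, b, hb, by ring⟩
  · rintro ⟨a, ha, b, hb, rfl⟩
    exact ⟨_, ⟨a, ha, rfl⟩, _, ⟨b, hb, rfl⟩, by ring⟩

theorem g_ne_bot {B : Matrix (Fin 2) (Fin 2) O} (hB : B.det ≠ 0) : g B ≠ ⊥ := by
  intro h
  apply hB
  have := span_pair_le_iff.1 h.le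
  rw [Ideal.mem_bot, Ideal.mem_bot] at this
  rw [Matrix.det_fin_two, this.1, this.2]
  ring

theorem exists_unit_mul_of_span_singleton_eq [IsDomain O] {x y : O}
    (h : Ideal.span {x} = Ideal.span {y}) : ∃ u : O, IsUnit u ∧ u * x = y := by
  obtain ⟨u, hu⟩ := Ideal.span_singleton_eq_span_singleton.1 h
  exact ⟨u, u.isUnit, by rw [mul_comm, hu]⟩

end Invariance

/-! ### Classification of double cosets by determinantal divisors -/

section Dedekind

variable {O : Type*} [CommRing O] [IsDedekindDomain O]

/-- A nonzero ideal has a complementary ideal with principal product. -/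
theorem exists_mul_eq_span_singleton {I : Ideal O} (hI : I ≠ ⊥) :
    ∃ (J : Ideal O) (c : O), c ≠ 0 ∧ I * J = Ideal.span {c} := by
  obtain ⟨c, hc, hc0⟩ := Submodule.exists_mem_ne_zero_of_ne_bot hI
  obtain ⟨J, hJ⟩ := Ideal.dvd_span_singleton.2 hc
  exact ⟨J, c, hc0, hJ.symm⟩

/-- Two pairs generating the same nonzero ideal are related by an invertible matrix of any
prescribed determinant. -/
theorem exists_transform_of_span_pair_eq {x z x' z' : O}
    (h : Ideal.span {x, z} = Ideal.span {x', z'}) (h0 : Ideal.span {x, z} ≠ ⊥) (u : O) :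
    ∃ p q r s : O, p * s - q * r = u ∧ p * x + q * z = x' ∧ r * x + s * z = z' := by
  obtain ⟨J, c, hc0, hJ⟩ := exists_mul_eq_span_singleton h0
  have hc : c ∈ Ideal.span {x, z} * J := hJ ▸ Ideal.mem_span_singleton_self c
  have hc' : c ∈ Ideal.span {x', z'} * J := h ▸ hc
  obtain ⟨a, ha, b, hb, hab⟩ := mem_span_pair_mul_iff.1 hc
  obtain ⟨a', ha', b', hb', hab'⟩ := mem_span_pair_mul_iff.1 hc'
  have key : ∀ s ∈ Ideal.span {x, z}, ∀ t ∈ J, c ∣ s * t := fun s hs t ht =>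
    Ideal.mem_span_singleton.1 (hJ ▸ Ideal.mul_mem_mul hs ht)
  have hx : x ∈ Ideal.span {x, z} := Ideal.subset_span (by simp)
  have hz : z ∈ Ideal.span {x, z} := Ideal.subset_span (by simp)
  have hx' : x' ∈ Ideal.span {x, z} := h ▸ Ideal.subset_span (by simp)
  have hz' : z' ∈ Ideal.span {x, z} := h ▸ Ideal.subset_span (by simp)
  -- The matrix sought is c⁻¹ [x', −b'; z', a'] · diag(1, u) · [a, b; −z, x]. Both outer factors
  -- have determinant c, and the last one sends (x, z) to (c, 0). Its entries are integral because
  -- 𝔞J = (c) for 𝔞 = (x, z).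
  obtain ⟨p, hp⟩ : c ∣ x' * a + u * (z * b') := (key _ hx' _ ha).add ((key _ hz _ hb').mul_left _)
  obtain ⟨q, hq⟩ : c ∣ x' * b - u * (x * b') := (key _ hx' _ hb).sub ((key _ hx _ hb').mul_left _)
  obtain ⟨r, hr⟩ : c ∣ z' * a - u * (z * a') := (key _ hz' _ ha).sub ((key _ hz _ ha').mul_left _)
  obtain ⟨s, hs⟩ : c ∣ z' * b + u * (x * a') := (key _ hz' _ hb).add ((key _ hx _ ha').mul_left _)
  refine ⟨p, q, r, s, ?_, ?_, ?_⟩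
  · apply mul_left_cancel₀ (mul_ne_zero hc0 hc0)
    calc c * c * (p * s - q * r) = (c * p) * (c * s) - (c * q) * (c * r) := by ring
      _ = u * (a' * x' + b' * z') * (a * x + b * z) := by rw [← hp, ← hq, ← hr, ← hs]; ring
      _ = c * c * u := by rw [hab, hab']; ring
  · apply mul_left_cancel₀ hc0
    calc c * (p * x + q * z) = (c * p) * x + (c * q) * z := by ring
      _ = x' * (a * x + b * z) := by rw [← hp, ← hq]; ring
      _ = c * x' := by rw [hab]; ring
  · apply mul_left_cancel₀ hc0
    calc c * (r * x + s * z) = (c * r) * x + (c * s) * z := by ring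
      _ = z' * (a * x + b * z) := by rw [← hr, ← hs]; ring
      _ = c * z' := by rw [hab]; ring

/-- A row operation makes the first row generate the ideal of all entries. -/
theorem exists_row_combination_span_eq {x y z w : O} (hD : x * w - y * z ≠ 0) :
    ∃ l : O, Ideal.span {x + l * z, y + l * w} = Ideal.span {x, y, z, w} := by
  classical
  obtain ⟨D, hDdef⟩ : ∃ D, D = x * w - y * z := ⟨_, rfl⟩
  rw [← hDdef] at hD
  set e : Ideal O := Ideal.span {x, y, z, w} with he
  have hx : x ∈ e := Ideal.subset_span (by simp)
  have hy : y ∈ e := Ideal.subset_span (by simp)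
  have hz : z ∈ e := Ideal.subset_span (by simp)
  have hw : w ∈ e := Ideal.subset_span (by simp)
  have he0 : e ≠ ⊥ := by
    rintro h
    rw [h, Ideal.mem_bot] at hx hy
    apply hD
    rw [hDdef, hx, hy]; ring
  have hDspan : Ideal.span {D} ≠ 0 := by simpa using hD
  set S := (Ideal.finite_factors hDspan).toFinset
  -- At each prime p dividing D the new row must not lie in p e. If the row (x, y) already avoids p
  -- e, take l ≡ 0; otherwise (z, w) avoids it, since the four entries generate e, and l ≡ 1 works.
  obtain ⟨l, hl⟩ := IsDedekindDomain.exists_forall_sub_mem_ideal (s := S)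
    (fun p => p.asIdeal) (fun _ => 1) (fun p _ => p.prime)
    (fun p _ q _ hpq h => hpq (IsDedekindDomain.HeightOneSpectrum.ext h))
    (fun p => if x ∈ p.1.asIdeal * e ∧ y ∈ p.1.asIdeal * e then 1 else 0)
  refine ⟨l, ?_⟩
  have hIe : Ideal.span {x + l * z, y + l * w} ≤ e :=
    span_pair_le_iff.2 ⟨add_mem hx (Ideal.mul_mem_left _ _ hz),
      add_mem hy (Ideal.mul_mem_left _ _ hw)⟩
  obtain ⟨J, hJ⟩ := Ideal.dvd_iff_le.2 hIe
  by_cases hJ1 : J = ⊤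
  · rw [hJ, hJ1, Ideal.mul_top]
  exfalso
  obtain ⟨p, hp, hJp⟩ := Ideal.exists_le_maximal J hJ1
  have hle : Ideal.span {x + l * z, y + l * w} ≤ p * e := by
    rw [hJ, mul_comm]
    exact Ideal.mul_mono_left hJp
  obtain ⟨h1, h2⟩ := span_pair_le_iff.1 hle
  -- Primes outside `S` are harmless: D is a combination of the entries of the new row.
  have hDp : D ∈ p := by
    have : D = (x + l * z) * w - (y + l * w) * z := by rw [hDdef]; ring
    rw [this]
    have hpe : p * e ≤ p := Ideal.mul_le_left
    exact sub_mem (Ideal.mul_mem_right _ _ (hpe h1)) (Ideal.mul_mem_right _ _ (hpe h2))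
  have hp0 : p ≠ ⊥ := by
    rintro rfl
    exact hD (by simpa using hDp)
  let P : IsDedekindDomain.HeightOneSpectrum O := ⟨p, hp.isPrime, hp0⟩
  have hPS : P ∈ S := by
    simpa [S, P, Ideal.dvd_span_singleton] using hDp
  have hlP := hl P hPS
  simp only [pow_one, P] at hlP
  split_ifs at hlP with hc
  · have hz' : z ∈ p * e := by
      have : z = (x + l * z) - x - (l - 1) * z := by ring
      rw [this]
      exact sub_mem (sub_mem h1 hc.1) (Ideal.mul_mem_mul hlP hz)
    have hw' : w ∈ p * e := by
      have : w = (y + l * w) - y - (l - 1) * w := by ring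
      rw [this]
      exact sub_mem (sub_mem h2 hc.2) (Ideal.mul_mem_mul hlP hw)
    have hle : e ≤ p * e := by
      rw [he, Ideal.span_le]
      rintro t (rfl | rfl | rfl | rfl)
      exacts [hc.1, hc.2, hz', hw']
    have : p * e = 1 * e := by rw [one_mul]; exact le_antisymm Ideal.mul_le_right hle
    exact hp.ne_top (by simpa using mul_right_cancel₀ he0 this)
  · apply hc
    rw [sub_zero] at hlP
    constructor
    · have : x = (x + l * z) - l * z := by ring
      rw [this]
      exact sub_mem h1 (Ideal.mul_mem_mul hlP hz)
    · have : y = (y + l * w) - l * w := by ring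
      rw [this]
      exact sub_mem h2 (Ideal.mul_mem_mul hlP hw)

theorem exists_mem_doubleCoset_span_row_eq (A : Matrix (Fin 2) (Fin 2) O) (hA : A.det ≠ 0) :
    ∃ B ∈ doubleCoset A, Ideal.span {B 0 0, B 0 1} = d₁ A := by
  obtain ⟨l, hl⟩ := exists_row_combination_span_eq (x := A 0 0) (y := A 0 1) (z := A 1 0)
    (w := A 1 1) (by rwa [Matrix.det_fin_two] at hA)
  let P : GL (Fin 2) O := Matrix.GeneralLinearGroup.mk'' !![1, l; 0, 1] (by simp)
  refine ⟨(P : Matrix (Fin 2) (Fin 2) O) * A, ⟨P, 1, by simp⟩, ?_⟩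
  simpa [P, Matrix.mul_apply, Fin.sum_univ_two, d₁] using hl

/-- Two matrices with the same determinant, whose first rows agree and generate an ideal
containing all entries, differ by a row operation. -/
theorem exists_row_operation {x y z w z' w' : O}
    (h0 : Ideal.span {x, y} ≠ ⊥) (hz : z ∈ Ideal.span {x, y}) (hw : w ∈ Ideal.span {x, y})
    (hz' : z' ∈ Ideal.span {x, y}) (hw' : w' ∈ Ideal.span {x, y})
    (hdet : x * w - y * z = x * w' - y * z') :
    ∃ l : O, z' = l * x + z ∧ w' = l * y + w := by
  obtain ⟨J, c, hc0, hJ⟩ := exists_mul_eq_span_singleton h0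
  have hc : c ∈ Ideal.span {x, y} * J := hJ ▸ Ideal.mem_span_singleton_self c
  obtain ⟨a, ha, b, hb, hab⟩ := mem_span_pair_mul_iff.1 hc
  have key : ∀ s ∈ Ideal.span {x, y}, ∀ t ∈ J, c ∣ s * t := fun s hs t ht =>
    Ideal.mem_span_singleton.1 (hJ ▸ Ideal.mul_mem_mul hs ht)
  -- Equal determinants make (z' − z, w' − w) proportional to (x, y); pairing with (a, b), for which
  -- ax + by = c, gives c times the factor l.
  obtain ⟨l, hl⟩ : c ∣ (z' - z) * a + (w' - w) * b :=
    (key _ (sub_mem hz' hz) _ ha).add (key _ (sub_mem hw' hw) _ hb)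
  refine ⟨l, ?_, ?_⟩
  · apply mul_left_cancel₀ hc0
    linear_combination x * hl - (z' - z) * hab + b * hdet
  · apply mul_left_cancel₀ hc0
    linear_combination y * hl - (w' - w) * hab - a * hdet

/-- Over a Dedekind domain, the determinantal divisors classify double cosets. -/
theorem mem_doubleCoset_iff {A B : Matrix (Fin 2) (Fin 2) O} (hA : A.det ≠ 0) :
    B ∈ doubleCoset A ↔ d₁ B = d₁ A ∧ d₂ B = d₂ A := by
  refine ⟨fun h => ⟨d₁_eq_of_mem_doubleCoset h, d₂_eq_of_mem_doubleCoset h⟩, ?_⟩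
  rintro ⟨h₁, h₂⟩
  have hB : B.det ≠ 0 := by
    intro h
    rw [d₂, d₂, h, Ideal.span_singleton_eq_span_singleton] at h₂
    exact hA (h₂.eq_zero_iff.1 rfl)
  obtain ⟨A', hA', hrA⟩ := exists_mem_doubleCoset_span_row_eq A hA
  obtain ⟨B', hB', hrB⟩ := exists_mem_doubleCoset_span_row_eq B hB
  refine mem_doubleCoset_trans (mem_doubleCoset_symm hB') (mem_doubleCoset_trans ?_ hA')
  have hA₁ : d₁ A' = d₁ A := d₁_eq_of_mem_doubleCoset hA'
  have hB₁ : d₁ B' = d₁ A := (d₁_eq_of_mem_doubleCoset hB').trans h₁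
  have hA₂ : d₂ A' = d₂ A := d₂_eq_of_mem_doubleCoset hA'
  have hB₂ : d₂ B' = d₂ A := (d₂_eq_of_mem_doubleCoset hB').trans h₂
  obtain ⟨u, hu, hdet⟩ := exists_unit_mul_of_span_singleton_eq (hA₂.trans hB₂.symm)
  rw [h₁] at hrB
  have hd0 : d₁ A ≠ ⊥ := fun h => g_ne_bot hA (le_bot_iff.1 (h ▸ g_le_d₁ A))
  -- The prescribed determinant u makes the determinants of `A' * Q` and `B'` equal, not merely
  -- associated, as the row operation below requires. `Q` is the transpose of the transformation
  -- because it acts on rows from the right.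
  obtain ⟨p, q, r, s, hpqrs, hp, hr⟩ :=
    exists_transform_of_span_pair_eq (hrA.trans hrB.symm) (hrA ▸ hd0) u
  let Q : GL (Fin 2) O := Matrix.GeneralLinearGroup.mk'' !![p, r; q, s] (by
    rw [Matrix.det_fin_two_of, mul_comm r, hpqrs]; exact hu)
  set C := A' * (Q : Matrix (Fin 2) (Fin 2) O) with hC
  have hC₁ : d₁ C = d₁ A := (d₁_mul_unit A' Q).trans hA₁
  have hCdet : C.det = B'.det := by
    rw [hC, Matrix.det_mul, ← hdet, mul_comm u]
    congr 1
    simp [Q, Matrix.det_fin_two_of, mul_comm r, hpqrs]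
  have h00 : C 0 0 = B' 0 0 := by
    rw [← hp]; simp [hC, Q, Matrix.mul_apply, Fin.sum_univ_two, mul_comm]
  have h01 : C 0 1 = B' 0 1 := by
    rw [← hr]; simp [hC, Q, Matrix.mul_apply, Fin.sum_univ_two, mul_comm]
  rw [Matrix.det_fin_two, Matrix.det_fin_two, h00, h01] at hCdet
  obtain ⟨l, hl, hl'⟩ := exists_row_operation (hrB ▸ hd0)
    (hrB ▸ hC₁ ▸ apply_mem_d₁ C 1 0) (hrB ▸ hC₁ ▸ apply_mem_d₁ C 1 1)
    (hrB ▸ hB₁ ▸ apply_mem_d₁ B' 1 0) (hrB ▸ hB₁ ▸ apply_mem_d₁ B' 1 1) hCdet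
  let P : GL (Fin 2) O := Matrix.GeneralLinearGroup.mk'' !![1, 0; l, 1] (by simp)
  refine ⟨P, Q, ?_⟩
  rw [Matrix.mul_assoc, ← hC]
  ext i j
  fin_cases i <;> fin_cases j <;>
    simp [P, Matrix.mul_apply, Fin.sum_univ_two, h00, h01, hl, hl']

end Dedekind

/-! ### Parametrization of the right cosets with given first column -/

section Parametrization

variable {O : Type*} [CommRing O] [IsDedekindDomain O]

theorem mul_le_mul_left_iff_of_ne_bot {I J K : Ideal O} (hI : I ≠ ⊥) :
    I * J ≤ I * K ↔ J ≤ K := by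
  rw [← Ideal.dvd_iff_le, ← Ideal.dvd_iff_le, mul_dvd_mul_iff_left hI]

/-- Cancelling (x, z) turns ε ∈ I into (x, z)ε ⊆ (D), a pair of divisibilities. -/
theorem mem_iff_dvd_of_span_pair_mul_eq {x z D : O} {I : Ideal O} (hD : D ≠ 0)
    (h : Ideal.span {x, z} * I = Ideal.span {D}) (ε : O) :
    ε ∈ I ↔ D ∣ x * ε ∧ D ∣ z * ε := by
  have h0 : Ideal.span {x, z} ≠ ⊥ := by
    rintro h'
    rw [h', Ideal.bot_mul, eq_comm, Ideal.span_singleton_eq_bot] at h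
    exact hD h
  rw [← Ideal.span_singleton_le_iff_mem, ← mul_le_mul_left_iff_of_ne_bot h0, h, Ideal.span_insert,
    Ideal.sup_mul, sup_le_iff, Ideal.span_singleton_mul_span_singleton,
    Ideal.span_singleton_mul_span_singleton, Ideal.span_singleton_le_span_singleton,
    Ideal.span_singleton_le_span_singleton]

/-- Two matrices with the same first column and the same determinant generate the same right coset
exactly if their second columns are congruent modulo the complementary ideal. -/
theorem rightCoset_eq_iff_sub_mem {x z y w y' w' D : O} {I : Ideal O} (hD : D ≠ 0)
    (h : Ideal.span {x, z} * I = Ideal.span {D}) (hdet : x * w - y * z = D)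
    (hdet' : x * w' - y' * z = D) :
    rightCoset !![x, y'; z, w'] = rightCoset !![x, y; z, w] ↔ y' - y ∈ I ∧ w' - w ∈ I := by
  rw [rightCoset_eq_iff, mem_iff_dvd_of_span_pair_mul_eq hD h,
    mem_iff_dvd_of_span_pair_mul_eq hD h]
  constructor
  · rintro ⟨P, hP⟩
    have h00 := congr_fun₂ hP 0 0
    have h01 := congr_fun₂ hP 0 1
    have h10 := congr_fun₂ hP 1 0
    have h11 := congr_fun₂ hP 1 1
    simp only [Matrix.mul_apply, Fin.sum_univ_two, Matrix.of_apply, Matrix.cons_val',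
      Matrix.cons_val_zero, Matrix.cons_val_one, Matrix.cons_val_fin_one] at h00 h01 h10 h11
    generalize (P : Matrix (Fin 2) (Fin 2) O) 0 0 = p at *
    generalize (P : Matrix (Fin 2) (Fin 2) O) 0 1 = q at *
    generalize (P : Matrix (Fin 2) (Fin 2) O) 1 0 = r at *
    generalize (P : Matrix (Fin 2) (Fin 2) O) 1 1 = s at *
    -- Multiplying `hP` by the adjugate of [x, y; z, w] shows that the entries of D(P − 1) are, up
    -- to sign, the products of x, z with y' − y, w' − w.
    refine ⟨⟨⟨q, ?_⟩, ⟨1 - p, ?_⟩⟩, ⟨⟨s - 1, ?_⟩, ⟨-r, ?_⟩⟩⟩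
    · linear_combination x * h01 - y * h00 + q * hdet
    · linear_combination z * h01 - w * h00 + (1 - p) * hdet
    · linear_combination x * h11 - y * h10 + (s - 1) * hdet
    · linear_combination z * h11 - w * h10 - r * hdet
  · rintro ⟨⟨⟨q, hq⟩, ⟨p, hp⟩⟩, ⟨⟨s, hs⟩, ⟨r, hr⟩⟩⟩
    -- Here P = 1 + N with N = [−p, q; −r, s]. Equal determinants give trace N = 0, and N has rank
    -- at most one, so det P = 1.
    have hsp : s = p := by
      apply mul_left_cancel₀ hD
      linear_combination hp - hs + hdet' - hdet
    have hpsqr : p * s = q * r := by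
      apply mul_left_cancel₀ (mul_ne_zero hD hD)
      calc D * D * (p * s) = (D * p) * (D * s) := by ring
        _ = (D * q) * (D * r) := by rw [← hp, ← hq, ← hr, ← hs]; ring
        _ = _ := by ring
    refine ⟨Matrix.GeneralLinearGroup.mk'' !![1 - p, q; -r, 1 + s] ?_, ?_⟩
    · rw [Matrix.det_fin_two_of]
      have : (1 - p) * (1 + s) - q * -r = 1 := by
        rw [hsp] at hpsqr ⊢
        linear_combination -hpsqr
      rw [this]
      exact isUnit_one
    · ext i j
      fin_cases i <;> fin_cases j <;>
        simp [Matrix.mul_apply, Fin.sum_univ_two] <;> apply mul_left_cancel₀ hD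
      · linear_combination z * hq - x * hp
      · linear_combination w * hq - y * hp - (y' - y) * hdet
      · linear_combination z * hs - x * hr
      · linear_combination w * hs - y * hr - (w' - w) * hdet

/-- For `𝔞 = (x, z)`, this produces a multiple `(α, β)` of `(x, z)` by an element of the fraction
field which generates `𝔡𝔞⁻¹` modulo `𝔟𝔞⁻¹`. -/
theorem exists_proportional_pair {x z : O} {𝔟 𝔡 : Ideal O} (h0 : Ideal.span {x, z} ≠ ⊥)
    (hb : 𝔟 ≠ ⊥) (hbd : 𝔟 ≤ 𝔡) :
    ∃ α β : O, x * β = z * α ∧ Ideal.span {α, β} ⊔ 𝔟 = 𝔡 ∧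
      ∀ s ∈ 𝔡, ∀ t ∈ 𝔡, x * t = z * s → ∃ r, s - r * α ∈ 𝔟 ∧ t - r * β ∈ 𝔟 := by
  obtain ⟨J, c, hc0, hJ⟩ := exists_mul_eq_span_singleton h0
  have hc' : Ideal.span {c} ≠ ⊥ := by simpa using hc0
  have hJ0 : J ≠ ⊥ := by
    rintro rfl
    rw [Ideal.mul_bot] at hJ
    exact hc' hJ.symm
  -- Since c⁻¹J is the inverse of (x, z), the multiplier is ρ/c and (α, β) = (ρ/c)(x, z).
  obtain ⟨ρ, hρ⟩ := IsDedekindDomain.exists_sup_span_eq (Ideal.mul_mono_left hbd : 𝔟 * J ≤ 𝔡 * J)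
    (mul_ne_zero hb hJ0)
  have hρmem : ρ ∈ 𝔡 * J := hρ ▸ Ideal.mem_sup_right (Ideal.mem_span_singleton_self ρ)
  have key : ∀ I : Ideal O, I * J * Ideal.span {x, z} = Ideal.span {c} * I := fun I => by
    rw [mul_assoc, mul_comm J, hJ, mul_comm]
  have hx : x ∈ Ideal.span {x, z} := Ideal.subset_span (by simp)
  have hz : z ∈ Ideal.span {x, z} := Ideal.subset_span (by simp)
  have hmul : ∀ I : Ideal O, ∀ t ∈ I * J, ∀ v ∈ Ideal.span {x, z}, ∃ i ∈ I, c * i = t * v :=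
    fun I t ht v hv => Ideal.mem_span_singleton_mul.1 (key I ▸ Ideal.mul_mem_mul ht hv)
  obtain ⟨α, hα, hα'⟩ := hmul 𝔡 ρ hρmem x hx
  obtain ⟨β, hβ, hβ'⟩ := hmul 𝔡 ρ hρmem z hz
  refine ⟨α, β, ?_, ?_, ?_⟩
  · apply mul_left_cancel₀ hc0
    linear_combination x * hβ' - z * hα'
  · apply mul_left_cancel₀ hc'
    have : Ideal.span {c} * Ideal.span {α, β} = Ideal.span {ρ} * Ideal.span {x, z} := by
      simp only [Ideal.span_insert, Ideal.mul_sup, Ideal.span_singleton_mul_span_singleton, hα',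
        hβ']
    rw [Ideal.mul_sup, this, ← key 𝔟, ← key 𝔡, ← hρ, Ideal.sup_mul, sup_comm]
  · intro s hs t ht hst
    have hc : c ∈ Ideal.span {x, z} * J := hJ ▸ Ideal.mem_span_singleton_self c
    obtain ⟨a, ha, b, hb, hab⟩ := mem_span_pair_mul_iff.1 hc
    -- By proportionality (s, t) = ((sa + tb)/c)(x, z). Splitting sa + tb as τ + ρr with τ ∈ 𝔟J
    -- leaves the remainder (τ/c)(x, z), whose entries lie in 𝔟.
    have hmem : s * a + t * b ∈ 𝔟 * J ⊔ Ideal.span {ρ} :=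
      hρ ▸ add_mem (Ideal.mul_mem_mul hs ha) (Ideal.mul_mem_mul ht hb)
    obtain ⟨τ, hτ, _, hr, hsum⟩ := Submodule.mem_sup.1 hmem
    obtain ⟨r, rfl⟩ := Ideal.mem_span_singleton.1 hr
    obtain ⟨τ₁, hτ₁, h₁⟩ := hmul 𝔟 τ hτ x hx
    obtain ⟨τ₂, hτ₂, h₂⟩ := hmul 𝔟 τ hτ z hz
    refine ⟨r, ?_, ?_⟩
    · convert hτ₁ using 1
      apply mul_left_cancel₀ hc0
      linear_combination -h₁ - x * hsum - r * hα' - s * hab - b * hst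
    · convert hτ₂ using 1
      apply mul_left_cancel₀ hc0
      linear_combination -h₂ - z * hsum - r * hβ' - t * hab + a * hst

/-- The first column contributes 𝔡J. The determinant forces 𝔡𝔫 into `d₁`, by cancelling (x, z) in
`d₂_le_g_mul_d₁`. Modulo 𝔡𝔫 the second column is r(α, β), which contributes r𝔡. -/
theorem d₁_eq_mul_sup_span {x z y₀ w₀ α β D : O} {𝔡 J 𝔫 : Ideal O} (hD : D ≠ 0)
    (hxz : Ideal.span {x, z} = 𝔡 * J) (hprod : Ideal.span {x, z} * (𝔡 * 𝔫) = Ideal.span {D})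
    (hdet₀ : x * w₀ - y₀ * z = D) (hy₀ : y₀ ∈ 𝔡 * 𝔫) (hw₀ : w₀ ∈ 𝔡 * 𝔫) (hαβ : x * β = z * α)
    (hsup : Ideal.span {α, β} ⊔ 𝔡 * 𝔫 = 𝔡) (r : O) :
    d₁ !![x, y₀ + r * α; z, w₀ + r * β] = 𝔡 * (Ideal.span {r} ⊔ (J ⊔ 𝔫)) := by
  have h0 : Ideal.span {x, z} ≠ ⊥ := by
    rintro h'
    rw [h', Ideal.bot_mul, eq_comm, Ideal.span_singleton_eq_bot] at hprod
    exact hD hprod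
  have hα : α ∈ 𝔡 := hsup.le (Ideal.mem_sup_left (Ideal.subset_span (by simp)))
  have hβ : β ∈ 𝔡 := hsup.le (Ideal.mem_sup_left (Ideal.subset_span (by simp)))
  have hle : ∀ i j, !![x, y₀ + r * α; z, w₀ + r * β] i j ∈ d₁ !![x, y₀ + r * α; z, w₀ + r * β] :=
    fun i j => apply_mem_d₁ _ i j
  have h00 := hle 0 0
  have h01 := hle 0 1
  have h10 := hle 1 0
  have h11 := hle 1 1
  simp only [Matrix.of_apply, Matrix.cons_val', Matrix.cons_val_zero,
      Matrix.cons_val_one, Matrix.cons_val_fin_one] at h00 h01 h10 h11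
  have hdet : d₂ !![x, y₀ + r * α; z, w₀ + r * β] = Ideal.span {D} := by
    rw [d₂, Matrix.det_fin_two_of]
    congr 2
    linear_combination hdet₀ + r * hαβ
  have hg : g !![x, y₀ + r * α; z, w₀ + r * β] = Ideal.span {x, z} := by simp [g]
  have h2 := d₂_le_g_mul_d₁ !![x, y₀ + r * α; z, w₀ + r * β]
  rw [hdet, hg, ← hprod, mul_le_mul_left_iff_of_ne_bot h0] at h2
  have h𝔡J : 𝔡 * J ≤ d₁ !![x, y₀ + r * α; z, w₀ + r * β] :=
    hxz ▸ span_pair_le_iff.2 ⟨h00, h10⟩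
  apply le_antisymm
  · rw [d₁_le_iff, Ideal.mul_sup, Ideal.mul_sup]
    have hx : x ∈ 𝔡 * J := hxz ▸ Ideal.subset_span (by simp)
    have hz : z ∈ 𝔡 * J := hxz ▸ Ideal.subset_span (by simp)
    have hr : ∀ t ∈ 𝔡, r * t ∈ 𝔡 * Ideal.span {r} := fun t ht => by
      rw [mul_comm r]
      exact Ideal.mul_mem_mul ht (Ideal.mem_span_singleton_self r)
    simp only [Fin.forall_fin_two, Matrix.of_apply, Matrix.cons_val', Matrix.cons_val_zero,
      Matrix.cons_val_one, Matrix.cons_val_fin_one]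
    refine ⟨⟨?_, ?_⟩, ⟨?_, ?_⟩⟩
    · exact Ideal.mem_sup_right (Ideal.mem_sup_left hx)
    · exact add_mem (Ideal.mem_sup_right (Ideal.mem_sup_right hy₀)) (Ideal.mem_sup_left (hr _ hα))
    · exact Ideal.mem_sup_right (Ideal.mem_sup_left hz)
    · exact add_mem (Ideal.mem_sup_right (Ideal.mem_sup_right hw₀)) (Ideal.mem_sup_left (hr _ hβ))
  · rw [Ideal.mul_sup, Ideal.mul_sup]
    refine sup_le ?_ (sup_le h𝔡J h2)
    conv_lhs => rw [← hsup]
    rw [Ideal.sup_mul, Ideal.span_insert, Ideal.sup_mul, Ideal.span_singleton_mul_span_singleton,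
      Ideal.span_singleton_mul_span_singleton]
    refine sup_le (sup_le ?_ ?_) (Ideal.mul_le_left.trans h2)
    · rw [Ideal.span_singleton_le_iff_mem]
      convert sub_mem h01 (h2 hy₀) using 1
      ring
    · rw [Ideal.span_singleton_le_iff_mem]
      convert sub_mem h11 (h2 hw₀) using 1
      ring

/-- The right cosets in `U A U` with first column generating `𝔞` are parametrized by the residue
classes modulo `𝔫 = d₂(A) 𝔞⁻¹ d₁(A)⁻¹` which are coprime to `𝔞 d₁(A)⁻¹ + 𝔫`. -/
theorem exists_parametrization {A : Matrix (Fin 2) (Fin 2) O} (hA : A.det ≠ 0) {𝔞 J 𝔫 : Ideal O}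
    (h𝔞 : 𝔞 = d₁ A * J) (hd₂ : d₂ A = 𝔞 * (d₁ A * 𝔫)) :
    ∃ F : O → Set (Matrix (Fin 2) (Fin 2) O), (∀ r r', F r = F r' ↔ r - r' ∈ 𝔫) ∧
      rightCosetsIn A 𝔞 = F '' {r | Ideal.span {r} ⊔ (J ⊔ 𝔫) = ⊤} := by
  have hDspan : Ideal.span {A.det} ≠ ⊥ := by simpa using hA
  have hd₂' : Ideal.span {A.det} = 𝔞 * (d₁ A * 𝔫) := hd₂
  have ha0 : 𝔞 ≠ ⊥ := by
    rintro rfl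
    exact hDspan (by rw [hd₂', Ideal.bot_mul])
  have hb0 : d₁ A * 𝔫 ≠ ⊥ := by
    intro h
    exact hDspan (by rw [hd₂', h, Ideal.mul_bot])
  have hd0 : d₁ A ≠ ⊥ := fun h => hb0 (by rw [h, Ideal.bot_mul])
  obtain ⟨x, hx, hx0⟩ := Submodule.exists_mem_ne_zero_of_ne_bot ha0
  obtain ⟨z, rfl⟩ := IsDedekindDomain.exists_eq_span_pair hx hx0
  -- D lies in 𝔞 · 𝔡𝔫, so the base column (y₀, w₀) can be chosen with entries in 𝔡𝔫; it then
  -- vanishes modulo 𝔡𝔫.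
  obtain ⟨w₀, hw₀, y₁, hy₁, hdet⟩ :=
    mem_span_pair_mul_iff.1 (hd₂' ▸ Ideal.mem_span_singleton_self A.det)
  have hdet₀ : x * w₀ - -y₁ * z = A.det := by linear_combination hdet
  have hy₀ := neg_mem hy₁
  generalize -y₁ = y₀ at hdet₀ hy₀
  have hbd : d₁ A * 𝔫 ≤ d₁ A := Ideal.mul_le_left
  obtain ⟨α, β, hαβ, hsup, hex⟩ := exists_proportional_pair ha0 hb0 hbd
  have hd₁ := d₁_eq_mul_sup_span hA h𝔞 hd₂'.symm hdet₀ hy₀ hw₀ hαβ hsup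
  have hdetr : ∀ r, x * (w₀ + r * β) - (y₀ + r * α) * z = A.det := fun r => by
    linear_combination hdet₀ + r * hαβ
  have htop : ∀ I : Ideal O, d₁ A * I = d₁ A ↔ I = ⊤ := fun I => by
    conv_lhs => rhs; rw [← mul_one (d₁ A)]
    rw [mul_right_inj' hd0, Ideal.one_eq_top]
  refine ⟨fun r => rightCoset !![x, y₀ + r * α; z, w₀ + r * β], ?_, ?_⟩
  · intro r r'
    rw [rightCoset_eq_iff_sub_mem hA hd₂'.symm (hdetr r') (hdetr r)]
    have h1 : y₀ + r * α - (y₀ + r' * α) = (r - r') * α := by ring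
    have h2 : w₀ + r * β - (w₀ + r' * β) = (r - r') * β := by ring
    rw [h1, h2, ← Ideal.span_singleton_le_iff_mem 𝔫,
      ← mul_le_mul_left_iff_of_ne_bot hd0]
    constructor
    · rintro ⟨h, h'⟩
      -- As 𝔡 = (α, β) + 𝔡𝔫, it suffices to test (r − r')𝔡 ⊆ 𝔡𝔫 on α and β.
      conv_lhs => rw [← hsup]
      rw [Ideal.sup_mul, Ideal.span_insert, Ideal.sup_mul, Ideal.span_singleton_mul_span_singleton,
        Ideal.span_singleton_mul_span_singleton]
      refine sup_le (sup_le ?_ ?_) Ideal.mul_le_left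
      · rwa [Ideal.span_singleton_le_iff_mem, mul_comm α]
      · rwa [Ideal.span_singleton_le_iff_mem, mul_comm β]
    · intro h
      have hα : α ∈ d₁ A := hsup.le (Ideal.mem_sup_left (Ideal.subset_span (by simp)))
      have hβ : β ∈ d₁ A := hsup.le (Ideal.mem_sup_left (Ideal.subset_span (by simp)))
      rw [mul_comm _ α, mul_comm _ β]
      exact ⟨h (Ideal.mul_mem_mul hα (Ideal.mem_span_singleton_self _)),
        h (Ideal.mul_mem_mul hβ (Ideal.mem_span_singleton_self _))⟩
  · ext C
    constructor
    · rintro ⟨B, hB, hgB, rfl, hsub⟩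
      rw [rightCoset_subset_doubleCoset_iff, mem_doubleCoset_iff hA] at hsub
      -- Normalize the representative: left multiplication by `P` of determinant u gives it first
      -- column (x, z) and determinant exactly `A.det`.
      obtain ⟨u, hu, hdet'⟩ := exists_unit_mul_of_span_singleton_eq hsub.2
      obtain ⟨p, q, r, s, hpqrs, hp, hr⟩ :=
        exists_transform_of_span_pair_eq hgB (g_ne_bot hB) u
      let P : GL (Fin 2) O := Matrix.GeneralLinearGroup.mk'' !![p, q; r, s] (by
        rw [Matrix.det_fin_two_of, hpqrs]; exact hu)
      obtain ⟨y, w, hyw⟩ : ∃ y w, (P : Matrix (Fin 2) (Fin 2) O) * B = !![x, y; z, w] := by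
        refine ⟨p * B 0 1 + q * B 1 1, r * B 0 1 + s * B 1 1, ?_⟩
        ext i j
        fin_cases i <;> fin_cases j <;> simp [P, Matrix.mul_apply, Fin.sum_univ_two, hp, hr]
      have hdetyw : x * w - y * z = A.det := by
        have := congr_arg Matrix.det hyw
        rw [Matrix.det_mul, Matrix.det_fin_two_of] at this
        rw [← this, ← hdet']
        simp [P, Matrix.det_fin_two_of, hpqrs]
      have hd₁yw : d₁ !![x, y; z, w] = d₁ A := by rw [← hyw, d₁_unit_mul, hsub.1]
      have hy : y ∈ d₁ A := hd₁yw ▸ apply_mem_d₁ !![x, y; z, w] 0 1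
      have hw : w ∈ d₁ A := hd₁yw ▸ apply_mem_d₁ !![x, y; z, w] 1 1
      obtain ⟨ρ, hρ₁, hρ₂⟩ := hex _ (sub_mem hy (hbd hy₀)) _ (sub_mem hw (hbd hw₀))
        (by linear_combination hdetyw - hdet₀)
      have hcoset : rightCoset !![x, y; z, w] = rightCoset !![x, y₀ + ρ * α; z, w₀ + ρ * β] := by
        rw [rightCoset_eq_iff_sub_mem hA hd₂'.symm (hdetr ρ) hdetyw]
        rw [sub_sub] at hρ₁ hρ₂
        exact ⟨hρ₁, hρ₂⟩
      refine ⟨ρ, ?_, ?_⟩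
      · obtain ⟨R, hR⟩ := rightCoset_eq_iff.1 hcoset
        rw [hR, d₁_unit_mul, hd₁, htop] at hd₁yw
        exact hd₁yw
      · rw [← rightCoset_unit_mul P B, hyw, hcoset]
    · rintro ⟨r, hr, rfl⟩
      have hdetB : (!![x, y₀ + r * α; z, w₀ + r * β]).det = A.det := by
        rw [Matrix.det_fin_two_of, hdetr]
      refine ⟨_, by rwa [hdetB], by simp [g], rfl, ?_⟩
      rw [rightCoset_subset_doubleCoset_iff, mem_doubleCoset_iff hA]
      exact ⟨by rw [hd₁, htop]; exact hr, by rw [d₂, hdetB, d₂]⟩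

end Parametrization

/-! ### Counting residue classes and multiplicativity of the norm -/

section Counting

/-- A set-theoretic section of φ identifies each fibre with the kernel. -/
theorem card_preimage_of_surjective {G H : Type*} [AddCommGroup G] [AddCommGroup H]
    (φ : G →+ H) (hφ : Function.Surjective φ) (T : Set H) :
    Nat.card (φ ⁻¹' T) = Nat.card T * Nat.card φ.ker := by
  rw [← Nat.card_prod]
  obtain ⟨σ, hσ⟩ := hφ.hasRightInverse
  refine Nat.card_congr
    { toFun := fun x => (⟨φ x.1, x.2⟩, ⟨x.1 - σ (φ x.1), ?_⟩)
      invFun := fun y => ⟨σ y.1.1 + y.2.1, ?_⟩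
      left_inv := fun x => ?_
      right_inv := fun y => ?_ }
  · rw [AddMonoidHom.mem_ker, map_sub, hσ, sub_self]
  · have h2 : φ y.2.1 = 0 := y.2.2
    rw [Set.mem_preimage, map_add, hσ, h2, add_zero]
    exact y.1.2
  · ext
    simp
  · have h2 : φ y.2.1 = 0 := y.2.2
    have h1 : φ (σ y.1.1 + y.2.1) = y.1.1 := by rw [map_add, hσ, h2, add_zero]
    ext
    · exact h1
    · simp [h1]

variable {O : Type*} [CommRing O]

/-- The number of residue classes modulo `𝔫` which avoid a finite set of maximal ideals
containing `𝔫`. -/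
theorem card_avoiding_maximal {𝔫 : Ideal O} [Finite (O ⧸ 𝔫)] (S : Finset (Ideal O))
    (hS : ∀ p ∈ S, p.IsMaximal ∧ 𝔫 ≤ p) :
    (Nat.card ((Ideal.Quotient.mk 𝔫) '' {r : O | ∀ p ∈ S, r ∉ p}) : ℚ) =
      norm 𝔫 * ∏ p ∈ S, (1 - (norm p : ℚ)⁻¹) := by
  classical
  have hmax : ∀ p : S, p.1.IsMaximal := fun p => (hS p.1 p.2).1
  have hle : ∀ p : S, 𝔫 ≤ p.1 := fun p => (hS p.1 p.2).2
  have hfin : ∀ p : S, Finite (O ⧸ p.1) := fun p =>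
    Finite.of_surjective _ (Ideal.Quotient.factor_surjective (hle p))
  let φ : O ⧸ 𝔫 →+* (∀ p : S, O ⧸ p.1) := RingHom.pi fun p => Ideal.Quotient.factor (hle p)
  have hφmk : ∀ r p, φ (Ideal.Quotient.mk 𝔫 r) p = Ideal.Quotient.mk p.1 r := fun r p => rfl
  have hφ : Function.Surjective φ := by
    intro f
    obtain ⟨r, hr⟩ := Ideal.pi_quotient_surjective (I := fun p : S => p.1)
      (fun p q hpq => Ideal.isCoprime_iff_sup_eq.2
        ((hmax p).coprime_of_ne (hmax q) fun h => hpq (Subtype.ext h))) f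
    exact ⟨Ideal.Quotient.mk 𝔫 r, funext hr⟩
  let T : Set (∀ p : S, O ⧸ p.1) := {f | ∀ p, f p ≠ 0}
  have himage : (Ideal.Quotient.mk 𝔫) '' {r : O | ∀ p ∈ S, r ∉ p} = φ.toAddMonoidHom ⁻¹' T := by
    ext q
    obtain ⟨r, rfl⟩ := Ideal.Quotient.mk_surjective q
    have : ∀ r : O, φ (Ideal.Quotient.mk 𝔫 r) ∈ T ↔ ∀ p ∈ S, r ∉ p := fun r => by
      simp only [T, Set.mem_ofPred_eq, hφmk, ne_eq, Ideal.Quotient.eq_zero_iff_mem, Subtype.forall]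
    constructor
    · rintro ⟨s, hs, h⟩
      rw [← h]
      exact (this s).2 hs
    · intro h
      exact ⟨r, (this r).1 h, rfl⟩
  have hT : Nat.card T = ∏ p : S, (norm p.1 - 1) := by
    have : Nat.card T = Nat.card (∀ p : S, {y : O ⧸ p.1 // y ≠ 0}) :=
      Nat.card_congr (Equiv.subtypePiEquivPi (p := fun _ y => y ≠ 0))
    rw [this, Nat.card_pi]
    refine Finset.prod_congr rfl fun p _ => ?_
    have := hfin p
    have h := Set.ncard_compl ({0} : Set (O ⧸ p.1))
    rw [Set.ncard_singleton] at h
    exact h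
  have hone : ∀ p : S, (norm p.1 : ℚ) ≠ 0 := fun p => by
    have := hfin p
    rw [Nat.cast_ne_zero]
    exact Nat.card_pos.ne'
  have hcard := card_preimage_of_surjective φ.toAddMonoidHom hφ T
  -- Taking the whole product as target gives N(𝔫) = ∏ N(p) · |ker φ|, which eliminates the kernel
  -- from the count.
  have hcard' := card_preimage_of_surjective φ.toAddMonoidHom hφ Set.univ
  rw [Set.preimage_univ, Nat.card_congr (Equiv.Set.univ _), Nat.card_congr (Equiv.Set.univ _),
    Nat.card_pi] at hcard'
  rw [himage, hcard, hT, norm, hcard', ← Finset.prod_coe_sort S fun p => 1 - (norm p : ℚ)⁻¹]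
  push_cast
  rw [mul_right_comm, ← Finset.prod_mul_distrib]
  congr 1
  refine Finset.prod_congr rfl fun p _ => ?_
  have := hfin p
  have hpos : 1 ≤ norm p.1 := Nat.card_pos
  have h0 := hone p
  rw [Nat.cast_sub hpos]
  change _ = (norm p.1 : ℚ) * _
  field_simp
  simp

theorem norm_eq_index (I : Ideal O) : norm I = I.toAddSubgroup.index := rfl

theorem finite_quotient_of_ne_bot (hO : ∀ x : O, x ≠ 0 → Finite (O ⧸ Ideal.span {x}))
    {I : Ideal O} (hI : I ≠ ⊥) : Finite (O ⧸ I) := by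
  obtain ⟨x, hx, hx0⟩ := Submodule.exists_mem_ne_zero_of_ne_bot hI
  have := hO x hx0
  exact Finite.of_surjective _
    (Ideal.Quotient.factor_surjective ((Ideal.span_singleton_le_iff_mem _).2 hx))

theorem norm_ne_zero (hO : ∀ x : O, x ≠ 0 → Finite (O ⧸ Ideal.span {x}))
    {I : Ideal O} (hI : I ≠ ⊥) : norm I ≠ 0 := by
  have := finite_quotient_of_ne_bot hO hI
  exact Nat.card_pos.ne'

variable [IsDedekindDomain O]

/-- With I = IJ + (c), multiplication by c induces an isomorphism O/J ≅ I/IJ, so the index of J is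
the relative index of IJ in I. -/
theorem norm_mul {I J : Ideal O} (hI : I ≠ ⊥) (hJ : J ≠ ⊥) : norm (I * J) = norm I * norm J := by
  obtain ⟨c, hc⟩ := IsDedekindDomain.exists_sup_span_eq (Ideal.mul_le_left : I * J ≤ I)
    (mul_ne_zero hI hJ)
  let f : O →+ O := AddMonoidHom.mulLeft c
  have hcomap : (I * J).toAddSubgroup.comap f = J.toAddSubgroup := by
    ext r
    change c * r ∈ I * J ↔ r ∈ J
    have hcI : c ∈ I := hc ▸ Ideal.mem_sup_right (Ideal.mem_span_singleton_self c)
    refine ⟨fun h => ?_, fun h => Ideal.mul_mem_mul hcI h⟩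
    rw [← Ideal.span_singleton_le_iff_mem, ← mul_le_mul_left_iff_of_ne_bot hI]
    conv_lhs => rw [← hc]
    rw [Ideal.sup_mul, Ideal.span_singleton_mul_span_singleton]
    exact sup_le Ideal.mul_le_left ((Ideal.span_singleton_le_iff_mem _).2 h)
  have hsup : f.range ⊔ (I * J).toAddSubgroup = I.toAddSubgroup := by
    have : f.range = (Ideal.span {c}).toAddSubgroup := by
      ext y
      change (∃ r, c * r = y) ↔ y ∈ Ideal.span {c}
      rw [Ideal.mem_span_singleton]
      exact exists_congr fun r => eq_comm
    rw [this, ← Submodule.sup_toAddSubgroup, sup_comm, hc]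
  have h := AddSubgroup.index_comap (I * J).toAddSubgroup f
  rw [hcomap, ← AddSubgroup.relIndex_sup_right, hsup] at h
  rw [norm_eq_index, norm_eq_index, norm_eq_index, h, mul_comm I.toAddSubgroup.index]
  have hle : (I * J).toAddSubgroup ≤ I.toAddSubgroup := fun _ h' => Ideal.mul_le_left h'
  exact (AddSubgroup.relIndex_mul_index hle).symm

theorem finite_primes_ge {I : Ideal O} (hI : I ≠ ⊥) : {p : Ideal O | p.IsPrime ∧ I ≤ p}.Finite := by
  refine ((Ideal.finite_factors hI).image fun v => v.asIdeal).subset ?_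
  rintro p ⟨hp, hle⟩
  exact ⟨⟨p, hp, fun h => hI (le_bot_iff.1 (h ▸ hle))⟩, Ideal.dvd_iff_le.2 hle, rfl⟩

theorem span_sup_eq_top_iff {I : Ideal O} (hI : I ≠ ⊥) (r : O) :
    Ideal.span {r} ⊔ I = ⊤ ↔ ∀ p ∈ (finite_primes_ge hI).toFinset, r ∉ p := by
  simp only [Set.Finite.mem_toFinset, Set.mem_ofPred_eq]
  constructor
  · rintro h p ⟨hp, hle⟩ hr
    exact hp.ne_top (top_le_iff.1 (h ▸ sup_le ((Ideal.span_singleton_le_iff_mem _).2 hr) hle))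
  · intro h
    by_contra hne
    obtain ⟨p, hp, hle⟩ := Ideal.exists_le_maximal _ hne
    exact h p ⟨hp.isPrime, le_sup_right.trans hle⟩
      ((Ideal.span_singleton_le_iff_mem _).1 (le_sup_left.trans hle))

/-- The integral form of the count of right cosets. -/
theorem mu_eq_of_integral (hO : ∀ x : O, x ≠ 0 → Finite (O ⧸ Ideal.span {x}))
    {A : Matrix (Fin 2) (Fin 2) O} (hA : A.det ≠ 0) {𝔞 J 𝔫 : Ideal O}
    (h𝔞 : 𝔞 = d₁ A * J) (hd₂ : d₂ A = 𝔞 * (d₁ A * 𝔫)) :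
    (rightCosetsIn A 𝔞).Finite ∧ {p : Ideal O | p.IsPrime ∧ J ⊔ 𝔫 ≤ p}.Finite ∧
      (mu 𝔞 A : ℚ) = norm (d₂ A) / (norm 𝔞 * norm (d₁ A)) *
        ∏ᶠ p ∈ {p : Ideal O | p.IsPrime ∧ J ⊔ 𝔫 ≤ p}, (1 - (norm p : ℚ)⁻¹) := by
  have hDspan : d₂ A ≠ ⊥ := by simpa [d₂] using hA
  have ha0 : 𝔞 ≠ ⊥ := by
    rintro rfl
    exact hDspan (by rw [hd₂, Ideal.bot_mul])
  have hb0 : d₁ A * 𝔫 ≠ ⊥ := by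
    intro h
    exact hDspan (by rw [hd₂, h, Ideal.mul_bot])
  have hd0 : d₁ A ≠ ⊥ := fun h => hb0 (by rw [h, Ideal.bot_mul])
  have hn0 : 𝔫 ≠ ⊥ := fun h => hb0 (by rw [h, Ideal.mul_bot])
  have hg0 : J ⊔ 𝔫 ≠ ⊥ := fun h => hn0 (sup_eq_bot_iff.1 h).2
  have := finite_quotient_of_ne_bot hO hn0
  obtain ⟨F, hF, hset⟩ := exists_parametrization hA h𝔞 hd₂
  let Fbar : O ⧸ 𝔫 → Set (Matrix (Fin 2) (Fin 2) O) :=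
    Quotient.lift F fun r r' h => (hF r r').2 ((Submodule.quotientRel_def 𝔫).1 h)
  have hFbar : ∀ r, Fbar (Ideal.Quotient.mk 𝔫 r) = F r := fun r => rfl
  have hinj : Function.Injective Fbar := by
    intro q q' h
    obtain ⟨r, rfl⟩ := Ideal.Quotient.mk_surjective q
    obtain ⟨r', rfl⟩ := Ideal.Quotient.mk_surjective q'
    exact Ideal.Quotient.eq.2 ((hF r r').1 h)
  set S := (finite_primes_ge hg0).toFinset with hS
  have hset' : rightCosetsIn A 𝔞 =
      Fbar '' ((Ideal.Quotient.mk 𝔫) '' {r : O | ∀ p ∈ S, r ∉ p}) := by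
    rw [hset, Set.image_image]
    simp only [hFbar, span_sup_eq_top_iff hg0, hS]
  refine ⟨hset' ▸ Set.toFinite _, finite_primes_ge hg0, ?_⟩
  have hmax : ∀ p ∈ S, p.IsMaximal ∧ 𝔫 ≤ p := by
    intro p hp
    rw [hS, Set.Finite.mem_toFinset] at hp
    exact ⟨hp.1.isMaximal fun h => hg0 (le_bot_iff.1 (h ▸ hp.2)), le_sup_right.trans hp.2⟩
  rw [mu, hset', Set.ncard_image_of_injective _ hinj, ← Nat.card_coe_set_eq,
    card_avoiding_maximal S hmax, finprod_mem_eq_finite_toFinset_prod _ (finite_primes_ge hg0)]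
  congr 1
  have h1 := norm_ne_zero hO ha0
  have h2 := norm_ne_zero hO hd0
  -- Since d₂ = 𝔞𝔡𝔫, the quotient of norms is N(𝔫).
  rw [hd₂, norm_mul ha0 hb0, norm_mul hd0 hn0]
  push_cast
  field_simp

end Counting

/-! ### Passage to fractional ideals and the main theorem -/

section Fractional

variable {O : Type*} [CommRing O] {K : Type*} [Field K] [Algebra O K]
  [IsFractionRing O K]

theorem divides_coe_iff {I J : Ideal O} :
    Divides (I : FractionalIdeal O⁰ K) (J : FractionalIdeal O⁰ K) ↔ ∃ 𝔠 : Ideal O, J = I * 𝔠 := by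
  refine exists_congr fun 𝔠 => ?_
  rw [← FractionalIdeal.coeIdeal_mul, FractionalIdeal.coeIdeal_inj]

theorem primesDividing_coe [IsDedekindDomain O] (I : Ideal O) :
    primesDividing (I : FractionalIdeal O⁰ K) = {p : Ideal O | p.IsPrime ∧ I ≤ p} := by
  ext p
  refine and_congr_right fun _ => ?_
  rw [divides_coe_iff, ← Ideal.dvd_iff_le]
  rfl

end Fractional

end RightCosets

theorem theorem2 {O : Type*} [CommRing O] [IsDedekindDomain O]
    (hO : ∀ x : O, x ≠ 0 → Finite (O ⧸ Ideal.span {x}))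
    {K : Type*} [Field K] [Algebra O K] [IsFractionRing O K]
    (A : Matrix (Fin 2) (Fin 2) O) (hA : A.det ≠ 0) (𝔞 : Ideal O) :
    (RightCosets.rightCosetsIn A 𝔞).Finite ∧
    ((RightCosets.Divides (RightCosets.d₁ A : FractionalIdeal O⁰ K)
          (𝔞 : FractionalIdeal O⁰ K) ∧
        RightCosets.Divides (𝔞 : FractionalIdeal O⁰ K)
          ((RightCosets.d₂ A : FractionalIdeal O⁰ K) *
            (RightCosets.d₁ A : FractionalIdeal O⁰ K)⁻¹)) →
      (RightCosets.primesDividing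
        ((𝔞 : FractionalIdeal O⁰ K) * (RightCosets.d₁ A : FractionalIdeal O⁰ K)⁻¹ +
          (RightCosets.d₂ A : FractionalIdeal O⁰ K) *
            (RightCosets.d₁ A : FractionalIdeal O⁰ K)⁻¹ *
            (𝔞 : FractionalIdeal O⁰ K)⁻¹)).Finite ∧
      (RightCosets.mu 𝔞 A : ℚ) =
        (RightCosets.norm (RightCosets.d₂ A) : ℚ) /
            ((RightCosets.norm 𝔞 : ℚ) * (RightCosets.norm (RightCosets.d₁ A) : ℚ)) *
          ∏ᶠ 𝔭 ∈ RightCosets.primesDividing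
            ((𝔞 : FractionalIdeal O⁰ K) * (RightCosets.d₁ A : FractionalIdeal O⁰ K)⁻¹ +
              (RightCosets.d₂ A : FractionalIdeal O⁰ K) *
                (RightCosets.d₁ A : FractionalIdeal O⁰ K)⁻¹ *
                (𝔞 : FractionalIdeal O⁰ K)⁻¹),
            (1 - (RightCosets.norm 𝔭 : ℚ)⁻¹)) ∧
    (¬ (RightCosets.Divides (RightCosets.d₁ A : FractionalIdeal O⁰ K)
          (𝔞 : FractionalIdeal O⁰ K) ∧
        RightCosets.Divides (𝔞 : FractionalIdeal O⁰ K)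
          ((RightCosets.d₂ A : FractionalIdeal O⁰ K) *
            (RightCosets.d₁ A : FractionalIdeal O⁰ K)⁻¹)) →
      RightCosets.mu 𝔞 A = 0) := by
  open RightCosets in
  have hDspan : d₂ A ≠ ⊥ := by simpa [d₂] using hA
  have hd0 : d₁ A ≠ ⊥ := fun h => g_ne_bot hA (le_bot_iff.1 (h ▸ g_le_d₁ A))
  have hd0' : (d₁ A : FractionalIdeal O⁰ K) ≠ 0 := FractionalIdeal.coeIdeal_ne_zero.2 hd0
  have hdiv : Divides (𝔞 : FractionalIdeal O⁰ K)
      ((d₂ A : FractionalIdeal O⁰ K) * (d₁ A : FractionalIdeal O⁰ K)⁻¹) ↔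
      ∃ 𝔫 : Ideal O, d₂ A = 𝔞 * (d₁ A * 𝔫) := by
    refine exists_congr fun 𝔫 => ?_
    rw [mul_inv_eq_iff_eq_mul₀ hd0', ← FractionalIdeal.coeIdeal_mul, ← FractionalIdeal.coeIdeal_mul,
      FractionalIdeal.coeIdeal_inj, mul_assoc, mul_comm 𝔫]
  rw [divides_coe_iff, hdiv]
  -- The conditions are necessary: any coset that is counted yields both factorizations, from
  -- `g_le_d₁` and `d₂_le_g_mul_d₁`.
  have hempty : (¬((∃ J, 𝔞 = d₁ A * J) ∧ ∃ 𝔫, d₂ A = 𝔞 * (d₁ A * 𝔫))) →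
      rightCosetsIn A 𝔞 = ∅ := by
    intro hne
    rw [Set.eq_empty_iff_forall_notMem]
    rintro C ⟨B, hB, rfl, rfl, hsub⟩
    rw [rightCoset_subset_doubleCoset_iff, mem_doubleCoset_iff hA] at hsub
    apply hne
    rw [← hsub.1, ← hsub.2]
    refine ⟨Ideal.dvd_iff_le.2 (g_le_d₁ B), ?_⟩
    obtain ⟨𝔫, h⟩ := Ideal.dvd_iff_le.2 (d₂_le_g_mul_d₁ B)
    exact ⟨𝔫, by rw [h, mul_assoc]⟩
  by_cases hcond : (∃ J, 𝔞 = d₁ A * J) ∧ ∃ 𝔫, d₂ A = 𝔞 * (d₁ A * 𝔫)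
  · obtain ⟨⟨J, hJ⟩, ⟨𝔫, h𝔫⟩⟩ := id hcond
    obtain ⟨hfin, hprimes, hmu⟩ := mu_eq_of_integral hO hA hJ h𝔫
    have ha0 : 𝔞 ≠ ⊥ := by
      rintro rfl
      exact hDspan (by rw [h𝔫, Ideal.bot_mul])
    have ha0' : (𝔞 : FractionalIdeal O⁰ K) ≠ 0 := FractionalIdeal.coeIdeal_ne_zero.2 ha0
    -- The two fractional summands are the integral ideals J and 𝔫, so their sum is J ⊔ 𝔫.
    have h1 : (𝔞 : FractionalIdeal O⁰ K) * (d₁ A : FractionalIdeal O⁰ K)⁻¹ = J := by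
      rw [mul_inv_eq_iff_eq_mul₀ hd0', ← FractionalIdeal.coeIdeal_mul, mul_comm, ← hJ]
    have h2 : (d₂ A : FractionalIdeal O⁰ K) * (d₁ A : FractionalIdeal O⁰ K)⁻¹ *
        (𝔞 : FractionalIdeal O⁰ K)⁻¹ = 𝔫 := by
      rw [mul_inv_eq_iff_eq_mul₀ ha0', mul_inv_eq_iff_eq_mul₀ hd0', ← FractionalIdeal.coeIdeal_mul,
        ← FractionalIdeal.coeIdeal_mul, h𝔫]
      congr 1
      ring
    rw [h1, h2, ← FractionalIdeal.coeIdeal_sup, primesDividing_coe]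
    exact ⟨hfin, fun _ => ⟨hprimes, hmu⟩, fun h => absurd hcond h⟩
  · have h := hempty hcond
    exact ⟨h ▸ Set.finite_empty, fun h' => absurd h' hcond, fun _ => by rw [mu, h, Set.ncard_empty]⟩
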